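/- For a complex number $s$ consider the linear differential equation of order $4$ on the complex upper half-plane $\mathbb{H}$ $$ D^4(f)-E_2 D^3(f)+\bigl(3D(E_2)+\alpha_1(s) E_4\bigr)D^2(f)-\Bigl(D^2(E_2)+\frac{\alpha_1(s)}{2}D(E_4)-\alpha_2(s)E_6\Bigr)D(f)+\alpha_3(s) E_8 f=0, \qquad (\flat_s) $$ where $D=\frac{1}{2\pi i}\frac{d}{d\tau}=q\frac{d}{dq}$ with $q=e^{2\pi i\tau}$, $E_k$ is the normalized Eisenstein series of weight $k$ on $SL_2(\mathbb{Z})$ (with constant term $1$), and $$ \alpha_1(s)=\frac{-25s^2+120s+1332}{7200},\qquad \alpha_2(s)=\frac{(5s+6)^2}{14400},\qquad \alpha_3(s)=\frac{(s-18)(s+6)(5s+6)^2}{8294400}. $$ A function $f$ on $\mathbb{H}$ is of \emph{character type} if $f(\tau)=q^{\beta}\sum_{n=0}^\infty a_nq^n$ for some $\beta\in\mathbb{Q}$ and non-negative integers $a_n$ with $a_0\ge 1$, where $q^\beta=e^{2\pi i\beta\tau}$; it is of \emph{CFT type} if it has such an expansion with $a_0=1$. **Proposition.** Let $s=-\frac{48}{5}$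 or $s=-\frac{38}{5}$. Then there is no complex linear subspace $U$ of the space of holomorphic solutions $f:\mathbb{H}\to\mathbb{C}$ of $(\flat_s)$ such that $U$ is invariant under the weight $0$ slash action $f(\tau)\mapsto f\bigl(\frac{a\tau+b}{c\tau+d}\bigr)$ of $SL_2(\mathbb{Z})$, $U$ is spanned by functions of character type, and $U$ contains a function of CFT type. -/

import Mathlib

open scoped Manifold MatrixGroups ModularForm

noncomputable section

namespace FourthOrderMLDE

open UpperHalfPlane Derivative

/-- The normalized Eisenstein series `E₈` of weight `8` on `SL₂(ℤ)`, with constant term `1`. -/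
abbrev E₈ : ModularForm 𝒮ℒ 8 := ModularForm.E (by norm_num : 3 ≤ 8)

/-- The coefficient `α₁(s)` of the equation. -/
def α₁ (s : ℂ) : ℂ := (-25 * s ^ 2 + 120 * s + 1332) / 7200

/-- The coefficient `α₂(s)` of the equation. -/
def α₂ (s : ℂ) : ℂ := (5 * s + 6) ^ 2 / 14400

/-- The coefficient `α₃(s)` of the equation. -/
def α₃ (s : ℂ) : ℂ := (s - 18) * (s + 6) * (5 * s + 6) ^ 2 / 8294400

/-- The left-hand side of the modular linear differential equation of order `4` and weight `0`
with parameter `s`, where `D = (2πi)⁻¹ d/dτ = q d/dq`. -/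
def mldeOp (s : ℂ) (f : ℍ → ℂ) : ℍ → ℂ := fun τ =>
  D (D (D (D f))) τ
    - EisensteinSeries.E2 τ * D (D (D f)) τ
    + (3 * D EisensteinSeries.E2 τ + α₁ s * ModularForm.E₄ τ) * D (D f) τ
    - (D (D EisensteinSeries.E2) τ + α₁ s / 2 * D (⇑ModularForm.E₄) τ
        - α₂ s * ModularForm.E₆ τ) * D f τ
    + α₃ s * E₈ τ * f τ

/-- The space of solutions of the equation with parameter `s`: the holomorphic functions on the
upper half-plane that satisfy it. -/
def solutionSpace (s : ℂ) : Submodule ℂ (ℍ → ℂ) where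
  carrier := {f | MDiff f ∧ ∀ τ : ℍ, mldeOp s f τ = 0}
  zero_mem' := by
    have h0 : D (0 : ℍ → ℂ) = 0 := normalizedDerivOfComplex_const 0
    refine ⟨mdifferentiable_const (c := (0 : ℂ)), fun τ => ?_⟩
    simp [mldeOp, h0]
  add_mem' := by
    rintro f g ⟨hf, hf0⟩ ⟨hg, hg0⟩
    refine ⟨hf.add hg, fun τ => ?_⟩
    have f1 := normalizedDerivOfComplex_mdifferentiable hf
    have f2 := normalizedDerivOfComplex_mdifferentiable f1
    have f3 := normalizedDerivOfComplex_mdifferentiable f2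
    have g1 := normalizedDerivOfComplex_mdifferentiable hg
    have g2 := normalizedDerivOfComplex_mdifferentiable g1
    have g3 := normalizedDerivOfComplex_mdifferentiable g2
    have h := congrArg₂ (· + ·) (hf0 τ) (hg0 τ)
    simp only [mldeOp, add_zero] at h
    simp only [mldeOp, normalizedDerivOfComplex_add _ _ hf hg,
      normalizedDerivOfComplex_add _ _ f1 g1, normalizedDerivOfComplex_add _ _ f2 g2,
      normalizedDerivOfComplex_add _ _ f3 g3, Pi.add_apply]
    linear_combination h
  smul_mem' := by
    rintro c f ⟨hf, hf0⟩
    refine ⟨hf.const_smul c, fun τ => ?_⟩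
    have f1 := normalizedDerivOfComplex_mdifferentiable hf
    have f2 := normalizedDerivOfComplex_mdifferentiable f1
    have f3 := normalizedDerivOfComplex_mdifferentiable f2
    have h := hf0 τ
    simp only [mldeOp] at h
    simp only [mldeOp, normalizedDerivOfComplex_smul _ _ hf,
      normalizedDerivOfComplex_smul _ _ f1, normalizedDerivOfComplex_smul _ _ f2,
      normalizedDerivOfComplex_smul _ _ f3, Pi.smul_apply, smul_eq_mul]
    linear_combination c * h

/-- `f(τ) = q^β ∑_{n ≥ 0} a_n q^n` for all `τ` in the upper half-plane,
where `q^x = exp(2πixτ)`. -/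
def HasQSeries (f : ℍ → ℂ) (β : ℚ) (a : ℕ → ℕ) : Prop :=
  ∀ τ : ℍ, HasSum
    (fun n : ℕ => (a n : ℂ) * Complex.exp (2 * Real.pi * Complex.I * ((β : ℂ) + n) * (τ : ℂ)))
    (f τ)

/-- `f` is of character type: `f = q^β ∑ a_n q^n` with `β` rational, all `a_n` non-negative
integers and `a_0 ≥ 1`. -/
def IsCharacterType (f : ℍ → ℂ) : Prop :=
  ∃ (β : ℚ) (a : ℕ → ℕ), 1 ≤ a 0 ∧ HasQSeries f β a

/-- `f` is of CFT type: `f = q^α (1 + ∑_{n ≥ 1} a_n q^n)` with `α` rational and all `a_n`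
non-negative integers. -/
def IsCFTType (f : ℍ → ℂ) : Prop :=
  ∃ (α : ℚ) (a : ℕ → ℕ), a 0 = 1 ∧ HasQSeries f α a

/-- `U` is invariant under the slash action of weight `0` of `SL₂(ℤ)`. -/
def IsModularInvariant (U : Submodule ℂ (ℍ → ℂ)) : Prop :=
  ∀ γ : SL(2, ℤ), ∀ f ∈ U, f ∣[(0 : ℤ)] γ ∈ U

end FourthOrderMLDE

end

noncomputable section

namespace FourthOrderMLDE

open UpperHalfPlane Derivative Filter Topology
open scoped PowerSeries

/-! The proof plays arithmetic of coefficients against a valence bound.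

The indicial polynomial of the equation has roots `(s + 6)/24`, `(18 - s)/24` and `±(5s + 6)/120`:
these are `-3/20, 23/20, ∓7/20` for `s = -48/5` and `-1/15, 16/15, ∓4/15` for `s = -38/5`. No two
roots differ by a positive integer, so a series solution is fixed by its exponent and leading
coefficient, and its coefficients follow recursively. At the root `-7/20` (resp. `-4/15`) the ratio
`a₁/a₀` is negative, so no character type solution has this exponent. At the first two roots some
`aₙ/a₀` is not an integer, which excludes `a₀ = 1`. Hence a CFT type solution has exponent `7/20`
(resp. `4/15`).

On the other hand, let an invariant space be spanned by `d` functions with distinct exponents. Their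
Wronskian is a nonzero modular form with character, of weight `d(d - 1)`, whose order at `i∞` is the
sum of the exponents; comparison with a power of the discriminant bounds this sum by `d(d - 1)/12`
(`sum_exponents_le`). Every set of admissible exponents containing `7/20` (resp. `4/15`) breaks this
bound. `not_exists_of_exponents` combines the two arguments. -/

/-- `qPow x τ = q^x = exp(2πixτ)`. -/
def qPow (x : ℚ) (τ : ℂ) : ℂ := Complex.exp (2 * Real.pi * Complex.I * (x : ℂ) * τ)

lemma qPow_add (x y : ℚ) (τ : ℂ) : qPow (x + y) τ = qPow x τ * qPow y τ := by
  rw [qPow, qPow, qPow, ← Complex.exp_add]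
  push_cast
  ring_nf

@[simp] lemma qPow_zero (τ : ℂ) : qPow 0 τ = 1 := by simp [qPow]

lemma norm_qPow (x : ℚ) (τ : ℂ) : ‖qPow x τ‖ = Real.exp (-(2 * Real.pi * x * τ.im)) := by
  rw [qPow, Complex.norm_exp]
  congr 1
  simp [Complex.mul_re, Complex.mul_im]

lemma qPow_sum {ι : Type*} (s : Finset ι) (x : ι → ℚ) (τ : ℂ) :
    qPow (∑ i ∈ s, x i) τ = ∏ i ∈ s, qPow (x i) τ := by
  classical
  induction s using Finset.induction_on with
  | empty => simp
  | insert i s hi ih => rw [Finset.sum_insert hi, Finset.prod_insert hi, qPow_add, ih]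

lemma qPow_nat (n : ℕ) (τ : ℍ) : qPow n τ = Function.Periodic.qParam 1 τ ^ n := by
  rw [qPow, Function.Periodic.qParam, ← Complex.exp_nat_mul]
  push_cast
  ring_nf

/-! ### Calculus of `q`-expansions with a rational leading exponent. -/

/-- `f = q^β φ(q)` with `φ` a power series converging on the upper half-plane. -/
def HasQExp (f : ℍ → ℂ) (β : ℚ) (φ : ℂ⟦X⟧) : Prop :=
  ∀ τ : ℍ, HasSum (fun n : ℕ => φ.coeff n * qPow (β + n) τ) (f τ)

namespace HasQExp

variable {f g : ℍ → ℂ} {β γ : ℚ} {φ ψ : ℂ⟦X⟧}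

lemma add (hf : HasQExp f β φ) (hg : HasQExp g β ψ) : HasQExp (f + g) β (φ + ψ) := fun τ => by
  simpa [add_mul] using (hf τ).add (hg τ)

lemma sub (hf : HasQExp f β φ) (hg : HasQExp g β ψ) : HasQExp (f - g) β (φ - ψ) := fun τ => by
  simpa [sub_mul] using (hf τ).sub (hg τ)

lemma smul (c : ℂ) (hf : HasQExp f β φ) : HasQExp (c • f) β (c • φ) := fun τ => by
  simpa [mul_assoc] using (hf τ).mul_left c

lemma mul (hf : HasQExp f β φ) (hg : HasQExp g γ ψ) : HasQExp (f * g) (β + γ) (φ * ψ) := by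
  intro τ
  have h1 := (hf τ).summable.norm
  have h2 := (hg τ).summable.norm
  have key : ∀ n : ℕ, (φ * ψ).coeff n * qPow (β + γ + n) τ =
      ∑ kl ∈ Finset.HasAntidiagonal.antidiagonal n,
        (φ.coeff kl.1 * qPow (β + kl.1) τ) * (ψ.coeff kl.2 * qPow (γ + kl.2) τ) := by
    intro n
    rw [PowerSeries.coeff_mul, Finset.sum_mul]
    refine Finset.sum_congr rfl fun kl hkl => ?_
    have : (n : ℚ) = kl.1 + kl.2 := by
      rw [← Finset.HasAntidiagonal.mem_antidiagonal.mp hkl]; push_cast; rfl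
    rw [this, show β + γ + (kl.1 + kl.2 : ℚ) = (β + kl.1) + (γ + kl.2) by ring, qPow_add]
    ring
  simp_rw [key, Pi.mul_apply]
  rw [← (hf τ).tsum_eq, ← (hg τ).tsum_eq,
    tsum_mul_tsum_eq_tsum_sum_antidiagonal_of_summable_norm h1 h2]
  exact (summable_norm_sum_mul_antidiagonal_of_summable_norm h1 h2).of_norm.hasSum

lemma one_mul' {e : ℂ⟦X⟧} (hg : HasQExp g 0 e) (hf : HasQExp f β φ) :
    HasQExp (g * f) β (e * φ) := by simpa using hg.mul hf

/-- Multiplying the series by `X ^ k` shifts the exponent by `k`. -/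
lemma of_X_pow_mul {k : ℕ} (hf : HasQExp f β (PowerSeries.X ^ k * φ)) :
    HasQExp f (β + k) φ := by
  intro τ
  have h := (hasSum_nat_add_iff' k).mpr (hf τ)
  have h0 : ∑ i ∈ Finset.range k,
      (PowerSeries.X ^ k * φ).coeff i * qPow (β + i) τ = 0 := by
    refine Finset.sum_eq_zero fun i hi => ?_
    rw [PowerSeries.coeff_X_pow_mul', if_neg (by simpa using hi), zero_mul]
  rw [h0, sub_zero] at h
  refine h.congr_fun fun n => ?_
  rw [add_comm n k, PowerSeries.coeff_X_pow_mul', if_pos (by simp), Nat.add_sub_cancel_left]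
  push_cast
  rw [add_assoc]

lemma untwist (hf : HasQExp f β φ) : HasQExp (fun τ => f τ * qPow (-β) τ) 0 φ := by
  intro τ
  refine ((hf τ).mul_right (qPow (-β) τ)).congr_fun fun n => ?_
  rw [mul_assoc, ← qPow_add]
  ring_nf

lemma isBoundedAtImInfty (hf : HasQExp f 0 φ) : IsBoundedAtImInfty f := by
  refine isBoundedAtImInfty_of_hasSum_qExpansion (h := 1) (c := fun n => φ.coeff n) one_pos
    fun τ => ?_
  refine (hf τ).congr_fun fun n => ?_
  rw [zero_add, qPow_nat, smul_eq_mul]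

/-- After untwisting and subtracting the constant term, the rest is `q` times a series that is
bounded at `i∞`, and `q → 0` there. -/
lemma tendsto (hf : HasQExp f β φ) :
    Tendsto (fun τ : ℍ => f τ * qPow (-β) τ) atImInfty (𝓝 (φ.coeff 0)) := by
  have h0 := hf.untwist
  set g : ℍ → ℂ := fun τ => f τ * qPow (-β) τ with hg
  obtain ⟨ψ, hψ⟩ := PowerSeries.X_dvd_iff.mpr
    (show (φ - PowerSeries.C (φ.coeff 0)).constantCoeff = 0 by simp)
  have hc : HasQExp (fun _ => φ.coeff 0) 0 (PowerSeries.C (φ.coeff 0)) := fun τ => by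
    have := hasSum_single (f := fun n : ℕ => (PowerSeries.C (φ.coeff 0)).coeff n *
      qPow (0 + n) τ) 0 fun n hn => by simp [PowerSeries.coeff_C, hn]
    simpa using this
  have h1 := h0.sub hc
  rw [hψ, ← pow_one PowerSeries.X] at h1
  have h2 := h1.of_X_pow_mul.untwist.isBoundedAtImInfty
  have hq : Tendsto (fun τ : ℍ => qPow 1 τ) atImInfty (𝓝 0) := by
    refine (qParam_tendsto_atImInfty one_pos).congr fun τ => ?_
    simpa using (qPow_nat 1 τ).symm
  have h3 : Tendsto (fun τ : ℍ => g τ - φ.coeff 0) atImInfty (𝓝 0) := by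
    refine (hq.zero_mul_isBoundedUnder_le
      (g := fun τ : ℍ => (g τ - φ.coeff 0) * qPow (-1) τ) ?_).congr fun τ => ?_
    · have := (Asymptotics.isBigO_one_iff ℝ).mp h2
      simpa [Function.comp_def] using this
    · rw [mul_left_comm, ← qPow_add]; simp
  simpa using h3.add_const (φ.coeff 0)

/-- Once the lowest power of `X` is divided out, the leading coefficient is the limit at `i∞` of the
zero function. This turns the differential equation into identities between coefficients. -/
lemma eq_zero (hf : HasQExp 0 β φ) : φ = 0 := by
  by_contra h
  classical
  obtain ⟨n, hn, hmin⟩ : ∃ n, φ.coeff n ≠ 0 ∧ ∀ m < n, φ.coeff m = 0 := by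
    have hex : ∃ n, φ.coeff n ≠ 0 := by
      by_contra! h'
      exact h (PowerSeries.ext h')
    exact ⟨Nat.find hex, Nat.find_spec hex, fun m hm => not_not.mp (Nat.find_min hex hm)⟩
  obtain ⟨ψ, rfl⟩ := PowerSeries.X_pow_dvd_iff.mpr hmin
  have h3 : ψ.coeff 0 = 0 := tendsto_nhds_unique hf.of_X_pow_mul.tendsto (by simp)
  rw [PowerSeries.coeff_X_pow_mul', if_pos le_rfl, Nat.sub_self] at hn
  exact hn h3

end HasQExp

/-- The operator `q d/dq` on `q^β ℂ⟦q⟧`. -/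
def theta (β : ℚ) (φ : ℂ⟦X⟧) : ℂ⟦X⟧ := PowerSeries.mk fun n => ((β : ℂ) + n) * φ.coeff n

@[simp] lemma coeff_theta (β : ℚ) (φ : ℂ⟦X⟧) (n : ℕ) :
    (theta β φ).coeff n = ((β : ℂ) + n) * φ.coeff n := by simp [theta]

/-- Termwise differentiation is justified on the strip `Im τ / 2 < Im w < 2 Im τ`: since `‖q^x‖` is
monotone in `Im w`, in a direction given by the sign of `x`, each term is dominated by the sum of
its norms at the two boundary heights. -/
lemma HasQExp.D {f : ℍ → ℂ} {β : ℚ} {φ : ℂ⟦X⟧} (hf : HasQExp f β φ) :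
    HasQExp (D f) β (theta β φ) := by
  intro τ
  set U : Set ℂ := {w | τ.im / 2 < w.im ∧ w.im < 2 * τ.im} with hU
  have hUo : IsOpen U :=
    (isOpen_lt continuous_const Complex.continuous_im).inter
      (isOpen_lt Complex.continuous_im continuous_const)
  have hτ := τ.im_pos
  have hτU : (τ : ℂ) ∈ U := ⟨by simp; linarith, by simp; linarith⟩
  have hpos : ∀ w ∈ U, 0 < w.im := fun w hw => by have := hw.1; linarith
  let F : ℕ → ℂ → ℂ := fun n w => φ.coeff n * qPow (β + n) w
  let τ₁ : ℍ := ⟨Complex.I * (τ.im / 2 : ℝ), by simp; linarith⟩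
  let τ₂ : ℍ := ⟨Complex.I * (2 * τ.im : ℝ), by simp; linarith⟩
  have hder : ∀ n w, HasDerivAt (F n)
      (φ.coeff n * (qPow (β + n) w * (2 * Real.pi * Complex.I * ((β + n : ℚ) : ℂ)))) w := by
    intro n w
    refine HasDerivAt.const_mul _ ?_
    have := ((hasDerivAt_id w).const_mul (2 * Real.pi * Complex.I * ((β + n : ℚ) : ℂ))).cexp
    simpa only [qPow, id, mul_one] using! this
  have hle : ∀ n w, w ∈ U → ‖F n w‖ ≤ ‖F n τ₁‖ + ‖F n τ₂‖ := by
    intro n w hw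
    simp only [F, norm_mul, norm_qPow, ← mul_add]
    refine mul_le_mul_of_nonneg_left ?_ (norm_nonneg _)
    have e1 : (τ₁ : ℂ).im = τ.im / 2 := by simp [τ₁]
    have e2 : (τ₂ : ℂ).im = 2 * τ.im := by simp [τ₂]
    rw [e1, e2]
    rcases le_total 0 (2 * Real.pi * ((β + n : ℚ) : ℝ)) with h | h
    · exact le_add_of_le_of_nonneg (Real.exp_le_exp.mpr (neg_le_neg
        (mul_le_mul_of_nonneg_left hw.1.le h))) (Real.exp_pos _).le
    · exact le_add_of_nonneg_of_le (Real.exp_pos _).le (Real.exp_le_exp.mpr (neg_le_neg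
        (mul_le_mul_of_nonpos_left hw.2.le h)))
  have h1 := Complex.hasSum_deriv_of_summable_norm
    ((hf τ₁).summable.norm.add (hf τ₂).summable.norm)
    (fun n w _ => (hder n w).differentiableAt.differentiableWithinAt) hUo hle hτU
  have h2 : (fun w => ∑' n, F n w) =ᶠ[𝓝 (τ : ℂ)] f ∘ ofComplex := by
    filter_upwards [hUo.mem_nhds hτU] with w hw
    have := (hf ⟨w, hpos w hw⟩).tsum_eq
    simpa [ofComplex_apply_of_im_pos (hpos w hw)] using this
  rw [h2.deriv_eq] at h1
  refine (h1.mul_left (2 * Real.pi * Complex.I)⁻¹).congr_fun fun n => ?_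
  rw [(hder n τ).deriv, coeff_theta]
  have : (2 * Real.pi * Complex.I : ℂ) ≠ 0 := Complex.two_pi_I_ne_zero
  push_cast
  field_simp

/-! ### Iterated Serre derivatives. -/

/-- The iterated Serre derivative of a function of weight `0`. -/
def serreIter : ℕ → (ℍ → ℂ) → ℍ → ℂ
  | 0, f => f
  | i + 1, f => serreDerivative ((2 * i : ℤ) : ℂ) (serreIter i f)

lemma serreIter_mdifferentiable {f : ℍ → ℂ} (hf : MDiff f) : ∀ i, MDiff (serreIter i f)
  | 0 => hf
  | i + 1 => serreDerivative_mdifferentiable _ (serreIter_mdifferentiable hf i)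

/-- Each Serre derivative raises the weight by `2` equivariantly. Plain derivatives would not
commute with the slash action, which is why the Wronskian below uses Serre derivatives. -/
lemma serreIter_slash {f : ℍ → ℂ} (hf : MDiff f) (γ : SL(2, ℤ)) (i : ℕ) :
    serreIter i f ∣[(2 * i : ℤ)] γ = serreIter i (f ∣[(0 : ℤ)] γ) := by
  induction i with
  | zero => simp [serreIter]
  | succ i ih =>
    rw [serreIter, serreIter, ← ih, ← serreDerivative_slash_equivariant
      (serreIter_mdifferentiable hf i)]
    rfl

lemma mdifferentiable_sum {ι : Type*} (s : Finset ι) (c : ι → ℂ) {f : ι → ℍ → ℂ}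
    (hf : ∀ i, MDiff (f i)) : MDiff (∑ i ∈ s, c i • f i) := by
  classical
  induction s using Finset.induction_on with
  | empty => exact mdifferentiable_const (c := (0 : ℂ))
  | insert i s hi ih =>
    rw [Finset.sum_insert hi]
    exact ((hf i).const_smul (c i)).add ih

lemma serreDerivative_sum (k : ℂ) {ι : Type*} (s : Finset ι) (c : ι → ℂ) {f : ι → ℍ → ℂ}
    (hf : ∀ i, MDiff (f i)) :
    serreDerivative k (∑ i ∈ s, c i • f i) = ∑ i ∈ s, c i • serreDerivative k (f i) := by
  classical
  induction s using Finset.induction_on with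
  | empty =>
    have h0 : D (0 : ℍ → ℂ) = 0 := normalizedDerivOfComplex_const 0
    ext z
    simp [h0]
  | insert i s hi ih =>
    rw [Finset.sum_insert hi, Finset.sum_insert hi, serreDerivative_add _ _ _
      ((hf i).const_smul (c i)) (mdifferentiable_sum s c hf), serreDerivative_smul _ _ _ (hf i), ih]

lemma serreIter_sum {ι : Type*} (s : Finset ι) (c : ι → ℂ) {f : ι → ℍ → ℂ}
    (hf : ∀ i, MDiff (f i)) (n : ℕ) :
    serreIter n (∑ i ∈ s, c i • f i) = ∑ i ∈ s, c i • serreIter n (f i) := by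
  induction n with
  | zero => rfl
  | succ n ih =>
    simp only [serreIter, ih]
    exact serreDerivative_sum _ s c fun i => serreIter_mdifferentiable (hf i) n

/-- The `q`-expansion of `E₂`. -/
def e2 : ℂ⟦X⟧ :=
  PowerSeries.mk fun n => if n = 0 then 1 else -24 * ArithmeticFunction.sigma 1 n

lemma hasQExp_E2 : HasQExp EisensteinSeries.E2 0 e2 := fun τ => by
  refine (EisensteinSeries.hasSum_qExpansion_E2 (z := τ)).congr_fun fun n => ?_
  rw [zero_add, qPow_nat, e2, PowerSeries.coeff_mk, smul_eq_mul]
  simp [Function.Periodic.qParam]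

/-- The leading coefficient of `serreIter i (q^β + ⋯)` is `(serrePoly i).eval β`. -/
def serrePoly : ℕ → Polynomial ℂ
  | 0 => 1
  | i + 1 => serrePoly i * (Polynomial.X - Polynomial.C (((2 * i : ℤ) : ℂ) * 12⁻¹))

lemma serrePoly_monic : ∀ i, (serrePoly i).Monic
  | 0 => Polynomial.monic_one
  | i + 1 => (serrePoly_monic i).mul (Polynomial.monic_X_sub_C _)

lemma serrePoly_natDegree : ∀ i, (serrePoly i).natDegree = i
  | 0 => Polynomial.natDegree_one
  | i + 1 => by
    rw [serrePoly, (serrePoly_monic i).natDegree_mul (Polynomial.monic_X_sub_C _),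
      serrePoly_natDegree i, Polynomial.natDegree_X_sub_C]

lemma HasQExp.serreIter {f : ℍ → ℂ} {β : ℚ} {φ : ℂ⟦X⟧} (hf : HasQExp f β φ) (i : ℕ) :
    ∃ ψ : ℂ⟦X⟧, HasQExp (serreIter i f) β ψ ∧
      ψ.coeff 0 = (serrePoly i).eval (β : ℂ) * φ.coeff 0 := by
  induction i with
  | zero => exact ⟨φ, hf, by simp [serrePoly]⟩
  | succ i ih =>
    obtain ⟨ψ, hψ, h0⟩ := ih
    have h := hψ.D.sub ((hasQExp_E2.one_mul' hψ).smul (((2 * i : ℤ) : ℂ) * 12⁻¹))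
    refine ⟨theta β ψ - (((2 * i : ℤ) : ℂ) * 12⁻¹) • (e2 * ψ), ?_, ?_⟩
    · convert h using 1
      ext z
      simp [FourthOrderMLDE.serreIter, mul_assoc]
    · have he : PowerSeries.constantCoeff e2 = 1 := by
        rw [← PowerSeries.coeff_zero_eq_constantCoeff_apply]; simp [e2]
      simp only [PowerSeries.coeff_zero_eq_constantCoeff] at h0
      have ht := coeff_theta β ψ 0
      simp only [PowerSeries.coeff_zero_eq_constantCoeff] at ht
      simp [serrePoly, he, ht, h0]
      ring

/-! ### The Wronskian: behaviour at `i∞` and automorphy. -/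

/-- The Wronskian of `f₀, …, f_{d-1}`, formed with iterated Serre derivatives. -/
def wronskian {d : ℕ} (f : Fin d → ℍ → ℂ) (τ : ℍ) : ℂ :=
  (Matrix.of fun i j : Fin d => serreIter j (f i) τ).det

section

variable {d : ℕ} {f : Fin d → ℍ → ℂ}

lemma wronskian_mdifferentiable (hf : ∀ i, MDiff (f i)) : MDiff (wronskian f) := by
  rw [UpperHalfPlane.mdifferentiable_iff]
  have : wronskian f ∘ ofComplex = fun z => ∑ σ : Equiv.Perm (Fin d), (σ.sign : ℂ) *
      ∏ i : Fin d, (serreIter i (f (σ i)) ∘ ofComplex) z := by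
    ext z
    simp [wronskian, Matrix.det_apply']
  rw [this]
  refine DifferentiableOn.fun_sum fun σ _ => DifferentiableOn.const_mul ?_ _
  refine DifferentiableOn.fun_finsetProd fun i _ => ?_
  exact UpperHalfPlane.mdifferentiable_iff.mp (serreIter_mdifferentiable (hf _) _)

/-- Scaling row `i` by `q^(-β i)` makes every entry converge, to the leading coefficient times
`(serrePoly j).eval (β i)`. As `serrePoly j` is monic of degree `j`, column operations reduce the
limit determinant to a Vandermonde one, nonzero when the exponents are distinct. -/
lemma tendsto_wronskian {β : Fin d → ℚ} {φ : Fin d → ℂ⟦X⟧}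
    (hq : ∀ i, HasQExp (f i) (β i) (φ i)) :
    Tendsto (fun τ : ℍ => wronskian f τ * qPow (-∑ i, β i) τ) atImInfty
      (𝓝 ((∏ i, (φ i).coeff 0) * (Matrix.vandermonde fun i => (β i : ℂ)).det)) := by
  choose ψ hψ h0 using fun i => (hq i).serreIter
  have h1 : Tendsto (fun τ : ℍ => Matrix.of fun i j : Fin d =>
      serreIter j (f i) τ * qPow (-β i) τ) atImInfty
      (𝓝 (Matrix.of fun i j : Fin d => (ψ i j).coeff 0)) := by
    refine tendsto_pi_nhds.mpr fun i => tendsto_pi_nhds.mpr fun j => ?_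
    exact (hψ i j).tendsto
  have h2 := ((Continuous.matrix_det continuous_id).tendsto _).comp h1
  have e1 : (Matrix.of fun i j : Fin d => (ψ i j).coeff 0).det =
      (∏ i, (φ i).coeff 0) * (Matrix.vandermonde fun i => (β i : ℂ)).det := by
    rw [Matrix.det_eval_matrixOfPolynomials_eq_det_vandermonde _ (fun i => serrePoly i)
      (fun i => serrePoly_natDegree i) (fun i => serrePoly_monic i), ← Matrix.det_mul_column]
    congr 1
    ext i j
    simp only [Matrix.of_apply, h0]
    ring
  rw [id, e1] at h2
  refine h2.congr fun τ => ?_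
  simp only [Function.comp_apply, id, wronskian]
  rw [← Finset.sum_neg_distrib, qPow_sum, mul_comm, ← Matrix.det_mul_column]
  congr 1
  ext i j
  simp [mul_comm]

/-- Column `j` has weight `2j`, and `∑ 2j = d(d - 1)`; the linear action on the functions
contributes `det ρ`. -/
lemma wronskian_smul (hf : ∀ i, MDiff (f i)) (γ : SL(2, ℤ)) {ρ : Matrix (Fin d) (Fin d) ℂ}
    (hρ : ∀ i, f i ∣[(0 : ℤ)] γ = ∑ l, ρ i l • f l) (τ : ℍ) :
    wronskian f (γ • τ) = denom γ τ ^ (d * (d - 1)) * (ρ.det * wronskian f τ) := by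
  have h1 : ∀ i j : Fin d, serreIter j (f i) (γ • τ) =
      (denom γ τ ^ (2 * (j : ℕ))) * ∑ l, ρ i l * serreIter j (f l) τ := by
    intro i j
    have := congrFun (serreIter_slash (hf i) γ j) τ
    rw [hρ, serreIter_sum _ _ hf, ModularForm.SL_slash_apply] at this
    simp only [Finset.sum_apply, Pi.smul_apply, smul_eq_mul] at this
    rw [← this, mul_left_comm, ← zpow_natCast, ← zpow_add₀ (denom_ne_zero γ τ)]
    simp
  have h2 : ∏ j : Fin d, (denom γ τ ^ (2 * (j : ℕ))) = denom γ τ ^ (d * (d - 1)) := by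
    rw [Finset.prod_pow_eq_pow_sum, ← Finset.mul_sum, Fin.sum_univ_eq_sum_range (fun i => i),
      mul_comm 2, Finset.sum_range_id_mul_two]
  rw [wronskian, wronskian, ← h2, ← Matrix.det_mul, ← Matrix.det_mul_row]
  congr 1
  ext i j
  exact (h1 i j).trans (by simp [Matrix.mul_apply])

end

/-! ### The generators `T` and `S`, and the valence bound. -/

lemma HasQExp.slash_T {f : ℍ → ℂ} {β : ℚ} {φ : ℂ⟦X⟧} (hf : HasQExp f β φ) :
    f ∣[(0 : ℤ)] ModularGroup.T = qPow β 1 • f := by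
  ext τ
  have h1 : (f ∣[(0 : ℤ)] ModularGroup.T) τ = f (ModularGroup.T • τ) := by
    rw [ModularForm.SL_slash_apply]; simp
  rw [h1]
  refine (hf _).unique (((hf τ).mul_left (qPow β 1)).congr_fun fun n => ?_)
  have h2 : ((ModularGroup.T • τ : ℍ) : ℂ) = τ + 1 := by
    rw [modular_T_smul, coe_vadd]; simp [add_comm]
  have h3 : qPow (β + n) ((τ : ℂ) + 1) = qPow (β + n) τ * qPow (β + n) 1 := by
    rw [qPow, qPow, qPow, ← Complex.exp_add]; ring_nf
  have h4 : qPow n 1 = 1 := by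
    rw [qPow, Complex.exp_eq_one_iff]
    exact ⟨n, by push_cast; ring⟩
  rw [h2, h3, qPow_add β n 1, h4]
  ring

lemma denom_T (τ : ℍ) : denom ModularGroup.T τ = 1 := by
  rw [ModularGroup.denom_apply]; simp [ModularGroup.T]

lemma denom_S (τ : ℍ) : denom ModularGroup.S τ = τ := by
  rw [ModularGroup.denom_apply]; simp [ModularGroup.S]

lemma discriminant_smul (γ : SL(2, ℤ)) (τ : ℍ) :
    ModularForm.discriminant (γ • τ) = denom γ τ ^ 12 * ModularForm.discriminant τ := by
  have h : ModularForm.discriminant ∣[(12 : ℤ)] γ = ModularForm.discriminant :=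
    SlashInvariantForm.slash_action_generators_SL2Z
      ModularForm.discriminant_S_invariant ModularForm.discriminant_T_invariant γ
  have h1 := congrFun h τ
  rw [ModularForm.SL_slash_apply] at h1
  rw [← h1, mul_left_comm, ← zpow_natCast, ← zpow_add₀ (denom_ne_zero γ τ)]
  simp

/-- A holomorphic function on the upper half-plane that is invariant under `SL₂(ℤ)` and tends to
`0` at `i∞` vanishes. -/
lemma eq_zero_of_invariant_of_isZeroAtImInfty {G : ℍ → ℂ} (hG : MDiff G)
    (hS : ∀ τ : ℍ, G (ModularGroup.S • τ) = G τ) (hT : ∀ τ : ℍ, G (ModularGroup.T • τ) = G τ)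
    (h0 : IsZeroAtImInfty G) : G = 0 := by
  have hinv : ∀ γ : SL(2, ℤ), G ∣[(0 : ℤ)] γ = G :=
    SlashInvariantForm.slash_action_generators_SL2Z
      (by ext τ; rw [ModularForm.SL_slash_apply, hS]; simp)
      (by ext τ; rw [ModularForm.SL_slash_apply, hT]; simp)
  let F : ModularForm 𝒮ℒ 0 :=
    { toFun := G
      slash_action_eq' := by
        rintro A ⟨A, rfl⟩
        exact hinv A
      holo' := hG
      -- Every cusp is equivalent to `i∞` and `G` is invariant, so the behaviour at `i∞` suffices.
      bdd_at_cusps' := fun hc => by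
        rw [Subgroup.IsArithmetic.isCusp_iff_isCusp_SL2Z] at hc
        rw [OnePoint.isBoundedAt_iff_forall_SL2Z hc]
        intro γ _
        rw [hinv]
        exact h0.isBoundedAtImInfty }
  obtain ⟨c, hc⟩ := ModularFormClass.levelOne_weight_zero_const F
  have hc' : G = fun _ => c := hc
  have : c = 0 := by
    rw [hc'] at h0
    exact tendsto_nhds_unique tendsto_const_nhds h0
  rw [hc', this]
  rfl

/-- The valence bound: the exponents at `i∞` of a space of functions invariant under `SL₂(ℤ)` that
is spanned by `d` functions with distinct exponents add up to at most `d (d - 1) / 12`. -/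
theorem sum_exponents_le {d : ℕ} {f : Fin d → ℍ → ℂ} {β : Fin d → ℚ} {φ : Fin d → ℂ⟦X⟧}
    (hf : ∀ i, MDiff (f i)) (hq : ∀ i, HasQExp (f i) (β i) (φ i)) (hβ : Function.Injective β)
    (hφ : ∀ i, (φ i).coeff 0 ≠ 0)
    (hS : ∀ i, f i ∣[(0 : ℤ)] ModularGroup.S ∈ Submodule.span ℂ (Set.range f)) :
    12 * ∑ i, β i ≤ (d * (d - 1) : ℕ) := by
  by_contra! hlt
  have hlim := tendsto_wronskian hq
  have hWγ := fun γ ρ hρ => wronskian_smul (f := f) (γ := γ) (ρ := ρ) hf hρ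
  have hkeven : Even (d * (d - 1)) := Nat.even_mul_pred_self d
  have hBp : ∀ τ : ℂ, ∏ i, qPow (β i) τ = qPow (∑ i, β i) τ := fun τ => (qPow_sum _ _ _).symm
  generalize hB : ∑ i, β i = B at hlt hlim hBp
  generalize hk : d * (d - 1) = k at hlt hWγ hkeven
  have hWd := wronskian_mdifferentiable hf
  generalize hW : wronskian f = W at hWd hWγ hlim
  set L : ℂ := (∏ i, (φ i).coeff 0) * (Matrix.vandermonde fun i => (β i : ℂ)).det with hL
  have hL0 : L ≠ 0 := by
    refine mul_ne_zero (Finset.prod_ne_zero_iff.mpr fun i _ => hφ i) ?_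
    exact Matrix.det_vandermonde_ne_zero_iff.mpr
      (fun i j hij => hβ (by exact_mod_cast hij))
  obtain ⟨τ₀, hτ₀⟩ : ∃ τ, W τ ≠ 0 := by
    obtain ⟨τ, hτ⟩ := (hlim.eventually_ne hL0).exists
    exact ⟨τ, left_ne_zero_of_mul hτ⟩
  have hWT : ∀ τ : ℍ, W (ModularGroup.T • τ) = qPow B 1 * W τ := by
    intro τ
    have := hWγ ModularGroup.T (ρ := Matrix.diagonal fun i => qPow (β i) 1)
      (fun i => by rw [(hq i).slash_T]; simp [Matrix.diagonal_apply, ite_smul]) τ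
    rw [this, Matrix.det_diagonal, hBp, denom_T, one_pow, one_mul]
  choose ρ hρ using fun i => (Submodule.mem_span_range_iff_exists_fun ℂ).mp (hS i)
  have hWS := hWγ ModularGroup.S (ρ := Matrix.of ρ) (fun i => (hρ i).symm)
  set c := (Matrix.of ρ).det
  -- `S² = -1` acts trivially on the upper half-plane, and its automorphy factor `(-1) ^ k` is `1`
  -- because `k = d(d - 1)` is even.
  have hc : c ^ 2 = 1 := by
    have h1 := hWS (ModularGroup.S • τ₀)
    have hSS : ModularGroup.S * ModularGroup.S = -1 := by decide
    rw [hWS τ₀, smul_smul, hSS, ModularGroup.SL_neg_smul, one_smul] at h1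
    have h2 : denom ModularGroup.S (ModularGroup.S • τ₀ : ℍ) * denom ModularGroup.S τ₀ = -1 := by
      have := ne_zero τ₀
      rw [denom_S, denom_S, modular_S_smul]
      simp [this]
    have h3 : W τ₀ = (denom ModularGroup.S (ModularGroup.S • τ₀ : ℍ) *
        denom ModularGroup.S τ₀) ^ k * (c ^ 2 * W τ₀) := by
      rw [mul_pow]
      linear_combination h1
    rw [h2, hkeven.neg_one_pow, one_mul] at h3
    exact mul_right_cancel₀ hτ₀ (by rw [← h3, one_mul])
  set M := B.den
  have hM : 0 < M := B.den_pos
  set Δ := ModularForm.discriminant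
  -- Both powers have weight `12kM`. The exponent `12M` is even, which removes the sign `c`, and
  -- divisible by the denominator of `B`, which removes the factor `q^B` picked up under `T`. `G`
  -- has order `M(12B - k)` at `i∞`, positive by the assumption to be refuted.
  let G : ℍ → ℂ := fun τ => W τ ^ (12 * M) * (Δ τ ^ (k * M))⁻¹
  have hG : MDiff G := by
    have h1 := UpperHalfPlane.mdifferentiable_iff.mp hWd
    have h2 := UpperHalfPlane.mdifferentiable_iff.mp (ModularFormClass.holo CuspForm.discriminant)
    rw [UpperHalfPlane.mdifferentiable_iff]
    exact (h1.pow _).mul ((h2.pow _).inv fun z hz =>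
      pow_ne_zero _ (ModularForm.discriminant_ne_zero _))
  have hGS : ∀ τ : ℍ, G (ModularGroup.S • τ) = G τ := by
    intro τ
    have h := denom_ne_zero ModularGroup.S τ
    have hD : Δ τ ≠ 0 := ModularForm.discriminant_ne_zero τ
    have hcM : c ^ (12 * M) = 1 := by
      rw [show 12 * M = 2 * (6 * M) by ring, pow_mul, hc, one_pow]
    simp only [G, hWS, Δ, discriminant_smul, mul_pow, hcM, one_mul, ← pow_mul]
    rw [show 12 * (k * M) = k * (12 * M) by ring]
    field_simp
  have hGT : ∀ τ : ℍ, G (ModularGroup.T • τ) = G τ := by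
    intro τ
    have hBM : qPow B 1 ^ (12 * M) = 1 := by
      rw [mul_comm, pow_mul, qPow, ← Complex.exp_nat_mul]
      have : Complex.exp (M * (2 * Real.pi * Complex.I * (B : ℂ) * 1)) = 1 := by
        rw [Complex.exp_eq_one_iff]
        refine ⟨B.num, ?_⟩
        have : (B : ℂ) * M = B.num := by exact_mod_cast B.mul_den_eq_num
        linear_combination (2 * Real.pi * Complex.I) * this
      rw [this, one_pow]
    simp only [G, hWT, Δ, discriminant_smul, mul_pow, hBM, denom_T, one_pow, one_mul]
  have hG0 : IsZeroAtImInfty G := by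
    have hWO : W =O[atImInfty] fun τ : ℍ => Real.exp (-(2 * Real.pi * B * τ.im)) := by
      have h2 := (hlim.isBigO_one ℂ).mul
        (Asymptotics.isBigO_refl (fun τ : ℍ => qPow B τ) atImInfty)
      refine (h2.congr_left fun τ => ?_).trans (Asymptotics.IsBigO.of_bound 1 ?_)
      · rw [mul_assoc, ← qPow_add]; simp
      · filter_upwards with τ
        rw [one_mul, one_mul, norm_qPow]; simp
    have hΔO := (ModularForm.exp_isBigO_discriminant.pow (k * M)).inv_rev
      (Eventually.of_forall fun τ h => absurd h (pow_ne_zero _ (Real.exp_pos _).ne'))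
    have hr : 0 < 2 * Real.pi * M * (12 * B - k : ℝ) := by
      have : (0 : ℝ) < 12 * B - k := by
        rw [sub_pos]; exact_mod_cast hlt
      have : (0 : ℝ) < M := by exact_mod_cast hM
      positivity
    refine ((hWO.pow (12 * M)).mul hΔO).trans_tendsto ?_
    have hlin : Tendsto (fun τ : ℍ => -((2 * Real.pi * M * (12 * B - k : ℝ)) * τ.im)) atImInfty
        atBot :=
      tendsto_neg_atTop_atBot.comp (tendsto_comap.const_mul_atTop hr)
    refine (Real.tendsto_exp_atBot.comp hlin).congr fun τ => ?_
    rw [Function.comp_apply, ← Real.exp_nat_mul, ← Real.exp_nat_mul, ← Real.exp_neg,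
      ← Real.exp_add]
    congr 1
    push_cast
    ring
  have := congrFun (eq_zero_of_invariant_of_isZeroAtImInfty hG hGS hGT hG0) τ₀
  exact mul_ne_zero (pow_ne_zero _ hτ₀)
    (inv_ne_zero (pow_ne_zero _ (ModularForm.discriminant_ne_zero _))) this

/-! ### The equation as a recursion on coefficients. -/

/-- The `q`-expansion `1 + c ∑ σ_k(n) q^n`. -/
def eisCoeff (c : ℂ) (k : ℕ) (n : ℕ) : ℂ :=
  if n = 0 then 1 else c * ArithmeticFunction.sigma k n

lemma hasQExp_E {k : ℕ} (hk : 3 ≤ k) (hk2 : Even k) {c : ℂ} (hc : -(2 * k / bernoulli k : ℂ) = c) :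
    HasQExp (ModularForm.E hk) 0 (PowerSeries.mk (eisCoeff c (k - 1))) := fun τ => by
  refine (ModularForm.hasSum_qExpansion (h := 1) (ModularForm.E hk) one_pos
    one_mem_strictPeriods_SL τ).congr_fun fun n => ?_
  rw [EisensteinSeries.E_qExpansion_coeff hk hk2, zero_add, qPow_nat, PowerSeries.coeff_mk,
    eisCoeff, hc]

lemma hasQExp_E₄ : HasQExp ModularForm.E₄ 0 (PowerSeries.mk (eisCoeff 240 3)) :=
  hasQExp_E _ (by decide) (by norm_num [bernoulli, bernoulli'_four])

lemma bernoulli_six : bernoulli 6 = 1 / 42 := by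
  decide +kernel

lemma bernoulli_eight : bernoulli 8 = -1 / 30 := by
  decide +kernel

lemma hasQExp_E₆ : HasQExp ModularForm.E₆ 0 (PowerSeries.mk (eisCoeff (-504) 5)) :=
  hasQExp_E _ (by decide) (by norm_num [bernoulli_six])

lemma hasQExp_E₈ : HasQExp E₈ 0 (PowerSeries.mk (eisCoeff 480 7)) :=
  hasQExp_E _ (by decide) (by norm_num [bernoulli_eight])

lemma e2_eq : e2 = PowerSeries.mk (eisCoeff (-24) 1) := rfl

/-- The coefficient of `q^k` in the equation, as a polynomial in `D`. -/
def mldeCoeff (s : ℂ) (k : ℕ) (x : ℂ) : ℂ :=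
  (if k = 0 then x ^ 4 else 0) - eisCoeff (-24) 1 k * x ^ 3
    + (3 * k * eisCoeff (-24) 1 k + α₁ s * eisCoeff 240 3 k) * x ^ 2
    - (k ^ 2 * eisCoeff (-24) 1 k + α₁ s / 2 * k * eisCoeff 240 3 k
      - α₂ s * eisCoeff (-504) 5 k) * x
    + α₃ s * eisCoeff 480 7 k

/-- The action of the equation on the coefficients of a series `q^β φ(q)`. -/
def mldeSeries (s : ℂ) (β : ℚ) (φ : ℂ⟦X⟧) : ℂ⟦X⟧ :=
  PowerSeries.mk fun n => ∑ kl ∈ Finset.HasAntidiagonal.antidiagonal n,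
    mldeCoeff s kl.1 (β + kl.2) * φ.coeff kl.2

lemma HasQExp.mldeOp {f : ℍ → ℂ} {β : ℚ} {φ : ℂ⟦X⟧} (s : ℂ) (hf : HasQExp f β φ) :
    HasQExp (mldeOp s f) β (mldeSeries s β φ) := by
  have h1 := hf.D
  have h2 := h1.D
  have h3 := h2.D
  have h4 := h3.D
  have hE := hasQExp_E2
  have hE1 := hE.D
  have hE2 := hE1.D
  have hE4 := hasQExp_E₄
  have hE4' := hE4.D
  have := (((h4.sub (hE.one_mul' h3)).add
    (((hE1.smul (3 : ℂ)).add (hE4.smul (α₁ s))).one_mul' h2)).sub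
    (((hE2.add (hE4'.smul (α₁ s / 2))).sub (hasQExp_E₆.smul (α₂ s))).one_mul' h1)).add
    ((hasQExp_E₈.smul (α₃ s)).one_mul' hf)
  have hs : mldeSeries s β φ =
      theta β (theta β (theta β (theta β φ))) - e2 * theta β (theta β (theta β φ)) +
        ((3 : ℂ) • theta 0 e2 + α₁ s • PowerSeries.mk (eisCoeff 240 3)) * theta β (theta β φ) -
        (theta 0 (theta 0 e2) + (α₁ s / 2) • theta 0 (PowerSeries.mk (eisCoeff 240 3)) -
          α₂ s • PowerSeries.mk (eisCoeff (-504) 5)) * theta β φ +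
        α₃ s • PowerSeries.mk (eisCoeff 480 7) * φ := by
    ext n
    -- Writing the leading term as a product with the series `1` puts all terms in the form of sums
    -- over the antidiagonal; this is the source of the `if k = 0` in `mldeCoeff`.
    rw [← one_mul (theta β (theta β (theta β (theta β φ))))]
    simp only [mldeSeries, map_add, map_sub, PowerSeries.coeff_mul, PowerSeries.coeff_mk,
      ← Finset.sum_add_distrib, ← Finset.sum_sub_distrib, PowerSeries.coeff_smul, coeff_theta,
      PowerSeries.coeff_one, e2_eq, smul_eq_mul, Rat.cast_zero, zero_add]
    refine Finset.sum_congr rfl fun kl _ => ?_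
    rw [mldeCoeff]
    split_ifs <;> ring
  rw [hs]
  exact this

lemma mldeSeries_eq_zero {s : ℂ} {f : ℍ → ℂ} {β : ℚ} {φ : ℂ⟦X⟧} (hf : f ∈ solutionSpace s)
    (hq : HasQExp f β φ) : mldeSeries s β φ = 0 := by
  have h := hq.mldeOp s
  rw [show mldeOp s f = 0 from funext hf.2] at h
  exact h.eq_zero

lemma sum_mldeCoeff_eq_zero {s : ℂ} {f : ℍ → ℂ} {β : ℚ} {φ : ℂ⟦X⟧} (hf : f ∈ solutionSpace s)
    (hq : HasQExp f β φ) (n : ℕ) :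
    ∑ kl ∈ Finset.HasAntidiagonal.antidiagonal n,
      mldeCoeff s kl.1 (β + kl.2) * φ.coeff kl.2 = 0 := by
  simpa [mldeSeries] using congrArg (PowerSeries.coeff n) (mldeSeries_eq_zero hf hq)

/-- The indicial polynomial; the form of the `αᵢ(s)` makes it split with roots linear in `s`. -/
lemma mldeCoeff_zero (s x : ℂ) : mldeCoeff s 0 x =
    (x - (s + 6) / 24) * (x - (18 - s) / 24) * (x - (5 * s + 6) / 120) *
      (x + (5 * s + 6) / 120) := by
  simp only [mldeCoeff, eisCoeff, α₁, α₂, α₃, if_true]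
  push_cast
  ring

/-- A solution `q^β φ(q)` is determined by the constant term of `φ` if no `β + n` with `n > 0` is
an exponent. -/
lemma eq_zero_of_coeff_zero {s : ℂ} {f : ℍ → ℂ} {β : ℚ} {φ : ℂ⟦X⟧} (hf : f ∈ solutionSpace s)
    (hq : HasQExp f β φ) (hβ : ∀ n : ℕ, 1 ≤ n → mldeCoeff s 0 ((β : ℂ) + n) ≠ 0)
    (h0 : φ.coeff 0 = 0) : f = 0 := by
  have hφ : ∀ n, φ.coeff n = 0 := by
    intro n
    induction n using Nat.strong_induction_on with
    | _ n ih =>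
      rcases Nat.eq_zero_or_pos n with rfl | hn
      · exact h0
      have h := sum_mldeCoeff_eq_zero hf hq n
      rw [Finset.sum_eq_single (0, n)] at h
      · exact (mul_eq_zero.mp h).resolve_left (hβ n hn)
      · rintro ⟨k, l⟩ hkl hne
        have hkl' := Finset.HasAntidiagonal.mem_antidiagonal.mp hkl
        simp only at hkl'
        have : l < n := by
          rcases Nat.eq_zero_or_pos k with rfl | hk
          · exact absurd (by simp [← hkl']) hne
          · omega
        simp [ih l this]
      · intro hne
        exact absurd (Finset.HasAntidiagonal.mem_antidiagonal.mpr (by simp)) hne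
  ext τ
  refine (hq τ).unique ?_
  simp [hφ]

lemma HasQSeries.hasQExp {f : ℍ → ℂ} {β : ℚ} {a : ℕ → ℕ} (h : HasQSeries f β a) :
    HasQExp f β (PowerSeries.mk fun n => (a n : ℂ)) := fun τ => by
  refine (h τ).congr_fun fun n => ?_
  rw [PowerSeries.coeff_mk, qPow]
  push_cast
  rfl

/-! ### Reduction to a condition on sets of exponents. -/

/-- Suppose that every character type solution has its exponent in `R`, that every CFT type
solution has exponent `β₀`, and that the exponents in `R` have no larger exponent in their class
modulo `ℤ`. If every subset of `R` containing `β₀` violates the valence bound, then no modular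
invariant space of solutions spanned by character type functions contains a CFT type function. -/
theorem not_exists_of_exponents {s : ℂ} (R : Finset ℚ) (β₀ : ℚ)
    (hR : ∀ f ∈ solutionSpace s, ∀ β a, 1 ≤ a 0 → HasQSeries f β a → β ∈ R)
    (hβ₀ : ∀ f ∈ solutionSpace s, ∀ β a, a 0 = 1 → HasQSeries f β a → β = β₀)
    (hint : ∀ β ∈ R, ∀ n : ℕ, 1 ≤ n → mldeCoeff s 0 ((β : ℂ) + n) ≠ 0)
    (hval : ∀ E ⊆ R, β₀ ∈ E → ((E.card * (E.card - 1) : ℕ) : ℚ) < 12 * ∑ β ∈ E, β) :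
    ¬ ∃ U : Submodule ℂ (ℍ → ℂ), U ≤ solutionSpace s ∧ IsModularInvariant U ∧
      (∃ S : Set (ℍ → ℂ), (∀ f ∈ S, IsCharacterType f) ∧ Submodule.span ℂ S = U) ∧
      ∃ f ∈ U, IsCFTType f := by
  classical
  rintro ⟨U, hU, hinv, ⟨S, hS, hspan⟩, f₀, hf₀, β, a₀, ha₀, hq₀⟩
  obtain rfl : β = β₀ := hβ₀ f₀ (hU hf₀) β a₀ ha₀ hq₀
  let P : ℚ → Prop := fun b => ∃ f ∈ U, ∃ a : ℕ → ℕ, 1 ≤ a 0 ∧ HasQSeries f b a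
  -- `E` is the set of exponents that occur in `U`. One function chosen for each of them will span
  -- `U`.
  set E := R.filter P with hE
  have hβE : β ∈ E := Finset.mem_filter.mpr
    ⟨hR f₀ (hU hf₀) β a₀ ha₀.ge hq₀, f₀, hf₀, a₀, ha₀.ge, hq₀⟩
  let e : Fin E.card ≃ E := E.equivFin.symm
  have hP : ∀ i, P (e i) := fun i => (Finset.mem_filter.mp (e i).2).2
  choose f hfU a ha hq using hP
  have hUspan : U ≤ Submodule.span ℂ (Set.range f) := by
    rw [← hspan, Submodule.span_le]
    intro g hg
    have hgU : g ∈ U := hspan ▸ Submodule.subset_span hg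
    obtain ⟨b, c, hc, hgq⟩ := hS g hg
    have hbE : b ∈ E := Finset.mem_filter.mpr ⟨hR g (hU hgU) b c hc hgq, g, hgU, c, hc, hgq⟩
    obtain ⟨i, hi⟩ := e.surjective ⟨b, hbE⟩
    have hqi := hq i
    rw [hi] at hqi
    -- The leading terms cancel in this combination of two solutions with the same exponent, so it
    -- vanishes and `g` is a multiple of `f i`.
    have h0 : (a i 0 : ℂ) • g - (c 0 : ℂ) • f i = 0 :=
      eq_zero_of_coeff_zero
        ((solutionSpace s).sub_mem ((solutionSpace s).smul_mem _ (hU hgU))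
          ((solutionSpace s).smul_mem _ (hU (hfU i))))
        ((hgq.hasQExp.smul _).sub (hqi.hasQExp.smul _))
        (hint b (Finset.mem_filter.mp hbE).1) (by simp [mul_comm])
    have hai : (a i 0 : ℂ) ≠ 0 := by
      have := ha i
      exact_mod_cast (by omega : a i 0 ≠ 0)
    rw [SetLike.mem_coe, ← Submodule.smul_mem_iff _ hai, sub_eq_zero.mp h0]
    exact Submodule.smul_mem _ _ (Submodule.subset_span ⟨i, rfl⟩)
  have hbound := sum_exponents_le (f := f) (β := fun i => (e i : ℚ))
    (fun i => (hU (hfU i)).1) (fun i => (hq i).hasQExp)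
    (Subtype.val_injective.comp e.injective)
    (fun i => by
      have := ha i
      simpa using (by omega : a i 0 ≠ 0))
    (fun i => hUspan (hinv _ _ (hfU i)))
  have hsum : ∑ i, (e i : ℚ) = ∑ b ∈ E, b := by
    rw [e.sum_comp (fun b : E => (b : ℚ)), ← Finset.sum_coe_sort E (fun b => b)]
  rw [hsum] at hbound
  exact absurd hbound (not_le.mpr (hval E (Finset.filter_subset _ _) hβE))

section Coefficients

variable {s : ℂ} {f : ℍ → ℂ} {β : ℚ} {a : ℕ → ℕ}

lemma sum_mldeCoeff_nat (hf : f ∈ solutionSpace s) (hq : HasQSeries f β a) (n : ℕ) :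
    ∑ i ∈ Finset.range (n + 1), mldeCoeff s (n - i) (β + i) * a i = 0 := by
  have h := sum_mldeCoeff_eq_zero hf hq.hasQExp n
  rw [Finset.Nat.sum_antidiagonal_eq_sum_range_succ_mk, ← Finset.sum_range_reflect] at h
  rw [← h]
  refine Finset.sum_congr rfl fun i hi => ?_
  have hi' : i ≤ n := by simpa [Nat.lt_succ_iff] using hi
  simp only [PowerSeries.coeff_mk]
  rw [show n + 1 - 1 - i = n - i by omega, Nat.sub_sub_self hi']

lemma indicial (hf : f ∈ solutionSpace s) (ha : 1 ≤ a 0) (hq : HasQSeries f β a) :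
    mldeCoeff s 0 β = 0 := by
  have h := sum_mldeCoeff_nat hf hq 0
  have : a 0 ≠ 0 := by omega
  simpa [this] using h

end Coefficients

/-! ### Explicit first coefficients at each exponent. -/

section

variable {f : ℍ → ℂ} {β : ℚ} {a : ℕ → ℕ}

lemma mldeCoeff_one (s x : ℂ) : mldeCoeff s 1 x =
    24 * x ^ 3 + (-72 + 240 * α₁ s) * x ^ 2 - (-24 + 120 * α₁ s + 504 * α₂ s) * x
      + 480 * α₃ s := by
  simp [mldeCoeff, eisCoeff]
  ring

lemma mldeCoeff_two (s x : ℂ) : mldeCoeff s 2 x =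
    72 * x ^ 3 + (-432 + 2160 * α₁ s) * x ^ 2 - (-288 + 2160 * α₁ s + 16632 * α₂ s) * x
      + 61920 * α₃ s := by
  have h : ∀ k ∈ ({1, 3, 5, 7} : Finset ℕ), ArithmeticFunction.sigma k 2 = 1 + 2 ^ k := by
    decide +kernel
  simp [mldeCoeff, eisCoeff, h]
  ring

lemma mldeCoeff_three (s x : ℂ) : mldeCoeff s 3 x =
    96 * x ^ 3 + (-864 + 6720 * α₁ s) * x ^ 2 - (-864 + 10080 * α₁ s + 122976 * α₂ s) * x
      + 1050240 * α₃ s := by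
  have h : ∀ k ∈ ({1, 3, 5, 7} : Finset ℕ), ArithmeticFunction.sigma k 3 = 1 + 3 ^ k := by
    decide +kernel
  simp [mldeCoeff, eisCoeff, h]
  ring

lemma mldeCoeff_four (s x : ℂ) : mldeCoeff s 4 x =
    168 * x ^ 3 + (-2016 + 17520 * α₁ s) * x ^ 2 - (-2688 + 35040 * α₁ s + 532728 * α₂ s) * x
      + 7926240 * α₃ s := by
  have h : ∀ k ∈ ({1, 3, 5, 7} : Finset ℕ), ArithmeticFunction.sigma k 4 = 1 + 2 ^ k + 4 ^ k := by
    decide +kernel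
  simp [mldeCoeff, eisCoeff, h]
  ring

/-- This excludes `a 0 = 1`, since `7 ∤ 115789`; the earlier ratios are integers, so the recursion
must be run up to `n = 4`. -/
lemma coeff_four_of_exponent_neg_three (hf : f ∈ solutionSpace (-48 / 5))
    (hq : HasQSeries f (-3 / 20) a) : 7 * a 4 = 115789 * a 0 := by
  have h1 := sum_mldeCoeff_nat hf hq 1
  have h2 := sum_mldeCoeff_nat hf hq 2
  have h3 := sum_mldeCoeff_nat hf hq 3
  have h4 := sum_mldeCoeff_nat hf hq 4
  norm_num [Finset.sum_range_succ, mldeCoeff_zero, mldeCoeff_one, mldeCoeff_two,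
    mldeCoeff_three, mldeCoeff_four, α₁, α₂, α₃] at h1 h2 h3 h4
  have e1 : (a 1 : ℂ) = 40 * a 0 := by
    -- The multiplier is the inverse of the indicial polynomial at `β + 1 = 17/20`. The multipliers
    -- below arise in the same way at `β + n`, up to the integer clearing the denominator of the
    -- result.
    linear_combination (-50 / 9 : ℂ) * h1
  have e2 : (a 2 : ℂ) = 381 * a 0 := by
    rw [e1] at h2
    linear_combination (50 / 231 : ℂ) * h2
  have e3 : (a 3 : ℂ) = 2865 * a 0 := by
    rw [e1, e2] at h3
    linear_combination (5 / 204 : ℂ) * h3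
  rw [e1, e2, e3] at h4
  have e : (7 * a 4 : ℂ) = 115789 * a 0 := by
    linear_combination (25 / 567 : ℂ) * h4
  exact_mod_cast e

lemma coeff_two_of_exponent_twenty_three (hf : f ∈ solutionSpace (-48 / 5))
    (hq : HasQSeries f (23 / 20) a) : 7 * a 2 = 769 * a 0 := by
  have h1 := sum_mldeCoeff_nat hf hq 1
  have h2 := sum_mldeCoeff_nat hf hq 2
  norm_num [Finset.sum_range_succ, mldeCoeff_zero, mldeCoeff_one, mldeCoeff_two,
    α₁, α₂, α₃] at h1 h2
  have e1 : (a 1 : ℂ) = 14 * a 0 := by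
    linear_combination (20 / 207 : ℂ) * h1
  rw [e1] at h2
  have e : (7 * a 2 : ℂ) = 769 * a 0 := by
    linear_combination (25 / 231 : ℂ) * h2
  exact_mod_cast e

/-- With natural coefficients this forces `a 0 = 0`, so the exponent `-7/20` never occurs for a
character type solution. -/
lemma coeff_one_of_exponent_neg_seven (hf : f ∈ solutionSpace (-48 / 5))
    (hq : HasQSeries f (-7 / 20) a) : a 1 + 63 * a 0 = 0 := by
  have h1 := sum_mldeCoeff_nat hf hq 1
  norm_num [Finset.sum_range_succ, mldeCoeff_zero, mldeCoeff_one,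
    α₁, α₂, α₃] at h1
  have e : (a 1 : ℂ) + 63 * a 0 = 0 := by
    linear_combination (-25 / 3 : ℂ) * h1
  exact_mod_cast e

/-- Here `4629` is odd, so `a 0 = 1` is impossible. -/
lemma coeff_three_of_exponent_neg_one (hf : f ∈ solutionSpace (-38 / 5))
    (hq : HasQSeries f (-1 / 15) a) : 8 * a 3 = 4629 * a 0 := by
  have h1 := sum_mldeCoeff_nat hf hq 1
  have h2 := sum_mldeCoeff_nat hf hq 2
  have h3 := sum_mldeCoeff_nat hf hq 3
  norm_num [Finset.sum_range_succ, mldeCoeff_zero, mldeCoeff_one, mldeCoeff_two, mldeCoeff_three,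
    α₁, α₂, α₃] at h1 h2 h3
  have e1 : (a 1 : ℂ) = 15 * a 0 := by
    linear_combination (-75 / 8 : ℂ) * h1
  have e2 : (a 2 : ℂ) = 100 * a 0 := by
    rw [e1] at h2
    linear_combination (45 / 286 : ℂ) * h2
  rw [e1, e2] at h3
  have e : (8 * a 3 : ℂ) = 4629 * a 0 := by
    linear_combination (75 / 448 : ℂ) * h3
  exact_mod_cast e

lemma coeff_one_of_exponent_sixteen (hf : f ∈ solutionSpace (-38 / 5))
    (hq : HasQSeries f (16 / 15) a) : 3 * a 1 = 28 * a 0 := by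
  have h1 := sum_mldeCoeff_nat hf hq 1
  norm_num [Finset.sum_range_succ, mldeCoeff_zero, mldeCoeff_one,
    α₁, α₂, α₃] at h1
  have e : (3 * a 1 : ℂ) = 28 * a 0 := by
    linear_combination (75 / 224 : ℂ) * h1
  exact_mod_cast e

lemma coeff_one_of_exponent_neg_four (hf : f ∈ solutionSpace (-38 / 5))
    (hq : HasQSeries f (-4 / 15) a) : a 1 + 56 * a 0 = 0 := by
  have h1 := sum_mldeCoeff_nat hf hq 1
  norm_num [Finset.sum_range_succ, mldeCoeff_zero, mldeCoeff_one,
    α₁, α₂, α₃] at h1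
  have e : (a 1 : ℂ) + 56 * a 0 = 0 := by
    linear_combination (-225 / 28 : ℂ) * h1
  exact_mod_cast e

end

/-! ### Admissible exponents and the two values of `s`. -/

section

variable {f : ℍ → ℂ} {β : ℚ} {a : ℕ → ℕ}

lemma mldeCoeff_zero_cast (r β : ℚ) : mldeCoeff r 0 β =
    (((β - (r + 6) / 24) * (β - (18 - r) / 24) * (β - (5 * r + 6) / 120) *
      (β + (5 * r + 6) / 120) : ℚ) : ℂ) := by
  rw [mldeCoeff_zero]
  push_cast
  rfl

lemma exponent_cases {r : ℚ} (hf : f ∈ solutionSpace r) (ha : 1 ≤ a 0) (hq : HasQSeries f β a) :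
    β = (r + 6) / 24 ∨ β = (18 - r) / 24 ∨ β = (5 * r + 6) / 120 ∨ β = -((5 * r + 6) / 120) := by
  have h := indicial hf ha hq
  rw [mldeCoeff_zero_cast, Rat.cast_eq_zero] at h
  rcases mul_eq_zero.mp h with h | h
  · rcases mul_eq_zero.mp h with h | h
    · rcases mul_eq_zero.mp h with h | h
      · exact Or.inl (sub_eq_zero.mp h)
      · exact Or.inr (Or.inl (sub_eq_zero.mp h))
    · exact Or.inr (Or.inr (Or.inl (sub_eq_zero.mp h)))
  · exact Or.inr (Or.inr (Or.inr (eq_neg_of_add_eq_zero_left h)))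

lemma mldeCoeff_zero_add_ne_zero {r : ℚ} {n : ℕ} (h1 : β + n ≠ (r + 6) / 24)
    (h2 : β + n ≠ (18 - r) / 24) (h3 : β + n ≠ (5 * r + 6) / 120)
    (h4 : β + n ≠ -((5 * r + 6) / 120)) : mldeCoeff r 0 ((β : ℂ) + n) ≠ 0 := by
  rw [show (β : ℂ) + n = ((β + n : ℚ) : ℂ) by push_cast; rfl, mldeCoeff_zero_cast,
    Rat.cast_ne_zero]
  exact mul_ne_zero (mul_ne_zero (mul_ne_zero (sub_ne_zero.mpr h1) (sub_ne_zero.mpr h2))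
    (sub_ne_zero.mpr h3)) (fun h => h4 (eq_neg_of_add_eq_zero_left h))

end

theorem not_exists_neg_fortyEight_fifths :
    ¬ ∃ U : Submodule ℂ (ℍ → ℂ), U ≤ solutionSpace (-48 / 5) ∧ IsModularInvariant U ∧
      (∃ S : Set (ℍ → ℂ), (∀ f ∈ S, IsCharacterType f) ∧ Submodule.span ℂ S = U) ∧
      ∃ f ∈ U, IsCFTType f := by
  have hs : ((-48 / 5 : ℚ) : ℂ) = -48 / 5 := by norm_num
  have hcases : ∀ f ∈ solutionSpace (-48 / 5), ∀ β a, 1 ≤ a 0 → HasQSeries f β a →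
      β = -3 / 20 ∨ β = 23 / 20 ∨ β = 7 / 20 := by
    intro f hf β a ha hq
    have h := exponent_cases (r := -48 / 5) (hs ▸ hf) ha hq
    norm_num at h
    rcases h with rfl | rfl | rfl | rfl
    · left; norm_num
    · simp
    · have := coeff_one_of_exponent_neg_seven hf (by convert hq using 1; norm_num)
      omega
    · simp
  refine not_exists_of_exponents {-3 / 20, 23 / 20, 7 / 20} (7 / 20)
    (fun f hf β a ha hq => by simpa using hcases f hf β a ha hq) ?_ ?_ ?_
  · intro f hf β a ha hq
    rcases hcases f hf β a ha.ge hq with rfl | rfl | h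
    · have := coeff_four_of_exponent_neg_three hf hq
      omega
    · have := coeff_two_of_exponent_twenty_three hf hq
      omega
    · exact h
  · intro β hβ n hn
    rw [← hs]
    simp only [Finset.mem_insert, Finset.mem_singleton] at hβ
    refine mldeCoeff_zero_add_ne_zero ?_ ?_ ?_ ?_ <;>
    -- No two roots of the indicial polynomial differ by a positive integer: clearing denominators
    -- leaves an integer equation that `1 ≤ n` rules out.
    · intro h
      rcases hβ with rfl | rfl | rfl <;>
      · field_simp at h
        norm_num at h
        norm_cast at h <;> omega
  -- There are four subsets containing `7/20`. The tightest is `{-3/20, 7/20}`, where `12 · 1/5 =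
  -- 12/5` only just exceeds `2`.
  · decide +kernel

theorem not_exists_neg_thirtyEight_fifths :
    ¬ ∃ U : Submodule ℂ (ℍ → ℂ), U ≤ solutionSpace (-38 / 5) ∧ IsModularInvariant U ∧
      (∃ S : Set (ℍ → ℂ), (∀ f ∈ S, IsCharacterType f) ∧ Submodule.span ℂ S = U) ∧
      ∃ f ∈ U, IsCFTType f := by
  have hs : ((-38 / 5 : ℚ) : ℂ) = -38 / 5 := by norm_num
  have hcases : ∀ f ∈ solutionSpace (-38 / 5), ∀ β a, 1 ≤ a 0 → HasQSeries f β a →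
      β = -1 / 15 ∨ β = 16 / 15 ∨ β = 4 / 15 := by
    intro f hf β a ha hq
    have h := exponent_cases (r := -38 / 5) (hs ▸ hf) ha hq
    norm_num at h
    rcases h with rfl | rfl | rfl | rfl
    · left; norm_num
    · simp
    · have := coeff_one_of_exponent_neg_four hf (by convert hq using 1; norm_num)
      omega
    · simp
  refine not_exists_of_exponents {-1 / 15, 16 / 15, 4 / 15} (4 / 15)
    (fun f hf β a ha hq => by simpa using hcases f hf β a ha hq) ?_ ?_ ?_
  · intro f hf β a ha hq
    rcases hcases f hf β a ha.ge hq with rfl | rfl | h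
    · have := coeff_three_of_exponent_neg_one hf hq
      omega
    · have := coeff_one_of_exponent_sixteen hf hq
      omega
    · exact h
  · intro β hβ n hn
    rw [← hs]
    simp only [Finset.mem_insert, Finset.mem_singleton] at hβ
    refine mldeCoeff_zero_add_ne_zero ?_ ?_ ?_ ?_ <;>
    · intro h
      rcases hβ with rfl | rfl | rfl <;>
      · field_simp at h
        norm_num at h
        norm_cast at h <;> omega
  -- The tightest subset is `{-1/15, 4/15}`, again with sum `1/5` and `12/5 > 2`.
  · decide +kernel

end FourthOrderMLDE

end

theorem mainTheorem6 (s : ℂ) (hs : s = -48 / 5 ∨ s = -38 / 5) :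
    ¬ ∃ U : Submodule ℂ (UpperHalfPlane → ℂ),
      U ≤ FourthOrderMLDE.solutionSpace s ∧
      FourthOrderMLDE.IsModularInvariant U ∧
      (∃ S : Set (UpperHalfPlane → ℂ),
        (∀ f ∈ S, FourthOrderMLDE.IsCharacterType f) ∧ Submodule.span ℂ S = U) ∧
      ∃ f ∈ U, FourthOrderMLDE.IsCFTType f := by
  rcases hs with rfl | rfl
  · exact FourthOrderMLDE.not_exists_neg_fortyEight_fifths
  · exact FourthOrderMLDE.not_exists_neg_thirtyEight_fifths
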